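/- Let $V$ be a finite non-empty set. For every $v\in V$ let a starting value $c_v\in\mathbb R$ and a pair $M(v)=(u,w)\in V\times V$ be given, and define functions $v:\mathbb N^+\to\mathbb R$ by $v(1)=c_v$ and $$v(n)=\max_{1\le m\le n-1}\bigl(u(n-m)+w(m)\bigr)\quad(n\ge 2,\ M(v)=(u,w)).$$ Let $g(n)=\max_{v\in V}v(n)$; the limit $\lambda=\lim_{n\to\infty}g(n)/n$ exists and is called the growth rate. A composition tree is a finite full binary tree whose vertices are labelled by elements of $V$ such that the left and right child of an inner vertex labelled $v$ are labelled $u$ and $w$, where $M(v)=(u,w)$; its value is the sum of the starting values of the labels of its leaves. A pseudo-loop is a composition tree with a marked leaf, different from the root, that has the same label as the root; its rate is the average of the starting values of the labels of all leaves other than the marked one. Theorem. There is an algorithm that, given $(c_v)_{v\in V}$, $M$ and a real number $\lambda_0$, decides in time $O(|V|^2)$ whether $\lambda_0<\lambda$. More precisely, there are a single program for a real random access machine (one step for each addition, subtraction, comparison, copying, or memory access) and an absolute constant $C$ such that on every such input the program halts after at most $C|V|^2$ steps and reports whether $\lambda_0<\lambda$. Whenever it reports that $\lambda_0\ge\lambda$,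 it has also computed, for every $v\in V$, the maximum $z_v$ of the values of all composition trees with root label $v$ in the shifted system, which has the starting values $c_v-\lambda_0$ and the same $M$. Moreover, $\lambda_0<\lambda$ holds if and only if for some $v\in V$ this maximum does not exist, and if and only if the shifted system has a pseudo-loop of positive rate. -/

import Mathlib

open Filter Topology

namespace Replacement

/-- A replacement system on a set `V`: a starting value `c v = v(1)` for every `v`, and a pair
`M v = (u, w)` of elements of `V` by which `v` is replaced. -/
structure RSystem (V : Type) where
  c : V → ℝ
  M : V → V × V

/-- Unlabelled (ordered, full) binary trees. A composition tree is determined by such a tree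
together with the label of its root. -/
inductive BTree : Type
  | leaf : BTree
  | node : BTree → BTree → BTree

/-- Binary trees with exactly one marked leaf: `here` is the tree that consists of the marked leaf
alone; in `inLeft K r` (`inRight l K`) the marked leaf lies in the left (right) subtree `K`. -/
inductive MarkedTree : Type
  | here : MarkedTree
  | inLeft : MarkedTree → BTree → MarkedTree
  | inRight : BTree → MarkedTree → MarkedTree

/-- The number of leaves. -/
def BTree.leaves : BTree → ℕ
  | .leaf => 1
  | .node l r => l.leaves + r.leaves

/-- The number of leaves other than the marked one. -/
def MarkedTree.leaves : MarkedTree → ℕ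
  | .here => 0
  | .inLeft K r => K.leaves + r.leaves
  | .inRight l K => l.leaves + K.leaves

namespace RSystem

variable {V : Type}

/-- `S.fn n v` is the number `v(n)` for `n ≥ 1` (the value at `n = 0` is not used): `v(1) = c_v`, and
`v(n)` is the maximum of `u(n - m) + w(m)` over `1 ≤ m ≤ n - 1`, where `M(v) = (u, w)`. In the
third line `n` is `k + 2` and `m` is `i + 1`. -/
noncomputable def fn (S : RSystem V) : ℕ → V → ℝ
  | 0 => fun _ => 0
  | 1 => S.c
  | k + 2 => fun v =>
      Finset.univ.sup' Finset.univ_nonempty fun i : Fin (k + 1) =>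
        S.fn (k + 2 - (i.1 + 1)) (S.M v).1 + S.fn (i.1 + 1) (S.M v).2
termination_by n => n
decreasing_by all_goals omega

theorem fn_one (S : RSystem V) (v : V) : S.fn 1 v = S.c v := by
  rw [fn]

/-- The defining recursion in its usual form. -/
theorem fn_isGreatest (S : RSystem V) (n : ℕ) (hn : 2 ≤ n) (v : V) :
    IsGreatest {x : ℝ | ∃ m : ℕ, 1 ≤ m ∧ m ≤ n - 1 ∧
      x = S.fn (n - m) (S.M v).1 + S.fn m (S.M v).2} (S.fn n v) := by
  obtain ⟨k, rfl⟩ : ∃ k, n = k + 2 := ⟨n - 2, by omega⟩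
  rw [fn]
  constructor
  · obtain ⟨i, -, hi⟩ := Finset.exists_mem_eq_sup' (Finset.univ_nonempty (α := Fin (k + 1)))
      (fun i : Fin (k + 1) =>
        S.fn (k + 2 - (i.1 + 1)) (S.M v).1 + S.fn (i.1 + 1) (S.M v).2)
    exact ⟨i.1 + 1, by omega, by omega, hi⟩
  · rintro x ⟨m, h1, h2, rfl⟩
    have h := Finset.le_sup' (fun i : Fin (k + 1) =>
        S.fn (k + 2 - (i.1 + 1)) (S.M v).1 + S.fn (i.1 + 1) (S.M v).2)
      (Finset.mem_univ (⟨m - 1, by omega⟩ : Fin (k + 1)))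
    simp only [Nat.sub_add_cancel h1] at h
    exact h

/-- `g(n)`, the maximum of `v(n)` over all `v`. -/
noncomputable def g [Fintype V] [Nonempty V] (S : RSystem V) (n : ℕ) : ℝ :=
  Finset.univ.sup' Finset.univ_nonempty fun v : V => S.fn n v

/-- `lam` is the growth rate of the system: `g(n) / n` converges to `lam`. -/
def IsGrowthRate [Fintype V] [Nonempty V] (S : RSystem V) (lam : ℝ) : Prop :=
  Tendsto (fun n : ℕ => S.g n / (n : ℝ)) atTop (𝓝 lam)

/-- The system with the starting values `c_v - x` in place of `c_v`. -/
def shift (S : RSystem V) (x : ℝ) : RSystem V where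
  c := fun v => S.c v - x
  M := S.M

/-- The value of the composition tree with root label `v` and shape `T`: the left and the right child
of a vertex labelled `v` are labelled by the two components of `M v`, and the value of the tree is
the sum of the starting values of the labels of its leaves. -/
def value (S : RSystem V) : V → BTree → ℝ
  | v, .leaf => S.c v
  | v, .node l r => S.value (S.M v).1 l + S.value (S.M v).2 r

/-- `z` is the largest value of a composition tree with root label `v`. -/
def IsMaxValue (S : RSystem V) (v : V) (z : ℝ) : Prop :=
  IsGreatest (Set.range (S.value v)) z

/-- The label of the marked leaf when the root is labelled `v`. -/
def markedLabel (S : RSystem V) : V → MarkedTree → V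
  | v, .here => v
  | v, .inLeft K _ => S.markedLabel (S.M v).1 K
  | v, .inRight _ K => S.markedLabel (S.M v).2 K

/-- The sum of the starting values of the labels of all leaves but the marked one, when the root is
labelled `v`. -/
def markedValue (S : RSystem V) : V → MarkedTree → ℝ
  | _, .here => 0
  | v, .inLeft K r => S.markedValue (S.M v).1 K + S.value (S.M v).2 r
  | v, .inRight l K => S.value (S.M v).1 l + S.markedValue (S.M v).2 K

/-- A pseudo-loop: a composition tree with a marked leaf, other than the root, that has the same label
as the root. -/
structure PseudoLoop (S : RSystem V) where
  root : V
  tree : MarkedTree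
  ne_here : tree ≠ .here
  label_eq : S.markedLabel root tree = root

/-- The rate of a pseudo-loop: the average of the values of all leaves but the marked one. -/
noncomputable def PseudoLoop.rate {S : RSystem V} (L : S.PseudoLoop) : ℝ :=
  S.markedValue L.root L.tree / (L.tree.leaves : ℝ)

end RSystem

/-- The instructions of a real random access machine. It has index registers, real registers, an index
memory and a real memory; the memories are addressed through index registers. On indices it
can only load constants, copy, take successors and compare, so that no index ever exceeds the
size of the input and the program by more than the running time. On reals it can load rational
constants, copy, add, subtract and compare. Every instruction takes one step. -/
inductive Instr : Type
  /-- `reg d := k` -/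
  | const (d k : ℕ)
  /-- `reg d := reg s` -/
  | copy (d s : ℕ)
  /-- `reg d := reg d + 1` -/
  | succ (d : ℕ)
  /-- `reg d := mem[reg a]` -/
  | load (d a : ℕ)
  /-- `mem[reg a] := reg s` -/
  | store (a s : ℕ)
  /-- `rreg d := q` -/
  | rconst (d : ℕ) (q : ℚ)
  /-- `rreg d := rreg s` -/
  | rcopy (d s : ℕ)
  /-- `rreg d := rreg s + rreg t` -/
  | radd (d s t : ℕ)
  /-- `rreg d := rreg s - rreg t` -/
  | rsub (d s t : ℕ)
  /-- `rreg d := rmem[reg a]` -/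
  | rload (d a : ℕ)
  /-- `rmem[reg a] := rreg s` -/
  | rstore (a s : ℕ)
  /-- go to line `l` -/
  | jump (l : ℕ)
  /-- if `reg i < reg j`, go to line `l` -/
  | jlt (i j l : ℕ)
  /-- if `rreg i < rreg j`, go to line `l` -/
  | rjlt (i j l : ℕ)

/-- A configuration of the machine: the number of the line to be executed next, the registers and the
memories. -/
structure Config where
  pc : ℕ
  reg : ℕ → ℕ
  rreg : ℕ → ℝ
  mem : ℕ → ℕ
  rmem : ℕ → ℝ

/-- The effect of one instruction. -/
noncomputable def Instr.exec (s : Config) : Instr → Config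
  | .const d k => { s with pc := s.pc + 1, reg := Function.update s.reg d k }
  | .copy d i => { s with pc := s.pc + 1, reg := Function.update s.reg d (s.reg i) }
  | .succ d => { s with pc := s.pc + 1, reg := Function.update s.reg d (s.reg d + 1) }
  | .load d a => { s with pc := s.pc + 1, reg := Function.update s.reg d (s.mem (s.reg a)) }
  | .store a i => { s with pc := s.pc + 1, mem := Function.update s.mem (s.reg a) (s.reg i) }
  | .rconst d q => { s with pc := s.pc + 1, rreg := Function.update s.rreg d (q : ℝ) }
  | .rcopy d i => { s with pc := s.pc + 1, rreg := Function.update s.rreg d (s.rreg i) }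
  | .radd d i j =>
      { s with pc := s.pc + 1, rreg := Function.update s.rreg d (s.rreg i + s.rreg j) }
  | .rsub d i j =>
      { s with pc := s.pc + 1, rreg := Function.update s.rreg d (s.rreg i - s.rreg j) }
  | .rload d a => { s with pc := s.pc + 1, rreg := Function.update s.rreg d (s.rmem (s.reg a)) }
  | .rstore a i => { s with pc := s.pc + 1, rmem := Function.update s.rmem (s.reg a) (s.rreg i) }
  | .jump l => { s with pc := l }
  | .jlt i j l => { s with pc := if s.reg i < s.reg j then l else s.pc + 1 }
  | .rjlt i j l => { s with pc := if s.rreg i < s.rreg j then l else s.pc + 1 }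

/-- A program is a finite list of instructions; the lines are numbered from `0`. -/
abbrev Program := List Instr

/-- One step of the machine. If the line number lies outside the program, nothing happens. -/
noncomputable def Program.step (P : Program) (s : Config) : Config :=
  match P[s.pc]? with
  | none => s
  | some i => i.exec s

/-- The machine has halted: the line number lies outside the program. -/
def Program.Halted (P : Program) (s : Config) : Prop := P.length ≤ s.pc

/-- The configuration after `t` steps. -/
noncomputable def Program.run (P : Program) (s : Config) (t : ℕ) : Config := P.step^[t] s

/-- The input `(S, x)` for a system `S` on `V = {0, …, n - 1}` and a real number `x`: index register `0`
holds `n`, real register `0` holds `x`, cells `2 v` and `2 v + 1` of the index memory hold the two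
components of `M v`, cell `v` of the real memory holds `c v`, and everything else is zero. -/
noncomputable def inputConfig {n : ℕ} (S : RSystem (Fin n)) (x : ℝ) : Config where
  pc := 0
  reg := fun i => if i = 0 then n else 0
  rreg := fun i => if i = 0 then x else 0
  mem := fun a =>
    if h : a / 2 < n then
      if a % 2 = 0 then ((S.M ⟨a / 2, h⟩).1 : ℕ) else ((S.M ⟨a / 2, h⟩).2 : ℕ)
    else 0
  rmem := fun a => if h : a < n then S.c ⟨a, h⟩ else 0

end Replacement

/-! The growth rate is the supremum of the rates of the pseudo-loops. Pumping one loop gives trees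
of every size whose value is at least size times rate, up to a constant (`exists_le_g`). Conversely,
if no rate exceeds `x`, then in the system shifted by `x` cutting out a loop never lowers a value,
so every tree is dominated by one of height less than `|V|` (`exists_height_lt_card`); tree values
are then bounded, and `g n ≤ n * x + Z` (`exists_g_le`). Hence `x` lies below the growth rate iff
the shifted system has a loop of positive rate, iff some maximal tree value is missing.

The algorithm is a Bellman-Ford iteration on the shifted system: `n` sweeps, each replacing `z v` by
`max (z v) (z u + z w)` in place. Entries are always values of trees, and after `r` sweeps they
dominate all trees of height at most `r`. If the last sweep changes nothing, `z` satisfies `z u + z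
w ≤ z v`, so it bounds all trees and consists of the maxima. If it changes something, some tree
beats all trees of height less than `n`, which forces a positive loop. -/

namespace Replacement

/-! ### Trees and marked trees -/

namespace BTree

/-- The height; a single leaf has height `0`. -/
def height : BTree → ℕ
  | .leaf => 0
  | .node l r => max l.height r.height + 1

/-- The left comb with `j + 1` leaves. -/
def comb : ℕ → BTree
  | 0 => .leaf
  | j + 1 => .node (comb j) .leaf

theorem leaves_pos : ∀ T : BTree, 0 < T.leaves
  | .leaf => Nat.one_pos
  | .node l r => Nat.add_pos_left l.leaves_pos r.leaves

theorem leaves_comb (j : ℕ) : (comb j).leaves = j + 1 := by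
  induction j with
  | zero => rfl
  | succ j ih => simp [comb, leaves, ih]

theorem height_comb (j : ℕ) : (comb j).height = j := by
  induction j with
  | zero => rfl
  | succ j ih => simp [comb, height, ih]

theorem finite_setOf_height_le (h : ℕ) : {T : BTree | T.height ≤ h}.Finite := by
  induction h with
  | zero =>
    refine (Set.finite_singleton BTree.leaf).subset ?_
    rintro (_ | ⟨l, r⟩) hT
    · rfl
    · simp [height] at hT
  | succ h ih =>
    refine ((Set.finite_singleton BTree.leaf).union (ih.image2 BTree.node ih)).subset ?_
    rintro (_ | ⟨l, r⟩) hT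
    · exact Or.inl rfl
    · simp only [Set.mem_ofPred_eq, height, Nat.add_le_add_iff_right, max_le_iff] at hT
      exact Or.inr ⟨l, hT.1, r, hT.2, rfl⟩

end BTree

namespace MarkedTree

/-- Replace the marked leaf by a tree. -/
def plug : MarkedTree → BTree → BTree
  | .here, T => T
  | .inLeft K r, T => .node (K.plug T) r
  | .inRight l K, T => .node l (K.plug T)

theorem leaves_plug (K : MarkedTree) (T : BTree) : (K.plug T).leaves = K.leaves + T.leaves := by
  induction K with
  | here => simp [plug, leaves]
  | inLeft K r ih => simp only [plug, leaves, BTree.leaves, ih]; omega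
  | inRight l K ih => simp only [plug, leaves, BTree.leaves, ih]; omega

theorem leaves_pos {K : MarkedTree} (hK : K ≠ .here) : 0 < K.leaves := by
  cases K with
  | here => exact absurd rfl hK
  | inLeft K r => exact Nat.add_pos_right _ r.leaves_pos
  | inRight l K => exact Nat.add_pos_left l.leaves_pos _

theorem leaves_iterate_plug (K : MarkedTree) (T : BTree) (m : ℕ) :
    (K.plug^[m] T).leaves = m * K.leaves + T.leaves := by
  induction m with
  | zero => simp
  | succ m ih => rw [Function.iterate_succ_apply', leaves_plug, ih]; ring

end MarkedTree

namespace RSystem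

variable {V : Type}

theorem value_plug (S : RSystem V) (K : MarkedTree) (T : BTree) (v : V) :
    S.value v (K.plug T) = S.markedValue v K + S.value (S.markedLabel v K) T := by
  induction K generalizing v with
  | here => simp [MarkedTree.plug, markedValue, markedLabel]
  | inLeft K r ih => simp only [MarkedTree.plug, markedValue, markedLabel, value, ih]; ring
  | inRight l K ih => simp only [MarkedTree.plug, markedValue, markedLabel, value, ih]; ring

theorem value_iterate_plug (S : RSystem V) (L : S.PseudoLoop) (T : BTree) (m : ℕ) :
    S.value L.root (L.tree.plug^[m] T) = m * S.markedValue L.root L.tree + S.value L.root T := by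
  induction m with
  | zero => simp
  | succ m ih =>
    rw [Function.iterate_succ_apply', value_plug, L.label_eq, ih]; push_cast; ring

theorem value_shift (S : RSystem V) (x : ℝ) (v : V) (T : BTree) :
    (S.shift x).value v T = S.value v T - T.leaves * x := by
  induction T generalizing v with
  | leaf => simp [value, shift, BTree.leaves]
  | node l r ihl ihr =>
    simp only [value, ihl, ihr, BTree.leaves]; push_cast; simp only [shift]; ring

theorem markedLabel_shift (S : RSystem V) (x : ℝ) (v : V) (K : MarkedTree) :
    (S.shift x).markedLabel v K = S.markedLabel v K := by
  induction K generalizing v with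
  | here => rfl
  | inLeft K r ih => exact ih _
  | inRight l K ih => exact ih _

theorem markedValue_shift (S : RSystem V) (x : ℝ) (v : V) (K : MarkedTree) :
    (S.shift x).markedValue v K = S.markedValue v K - K.leaves * x := by
  induction K generalizing v with
  | here => simp [markedValue, MarkedTree.leaves]
  | inLeft K r ih =>
    simp only [markedValue, ih, value_shift, MarkedTree.leaves]; push_cast; simp only [shift]; ring
  | inRight l K ih =>
    simp only [markedValue, ih, value_shift, MarkedTree.leaves]; push_cast; simp only [shift]; ring

namespace PseudoLoop

variable {S : RSystem V}

theorem leaves_pos (L : S.PseudoLoop) : (0 : ℝ) < L.tree.leaves :=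
  Nat.cast_pos.mpr (MarkedTree.leaves_pos L.ne_here)

theorem rate_pos_iff (L : S.PseudoLoop) : 0 < L.rate ↔ 0 < S.markedValue L.root L.tree :=
  div_pos_iff_of_pos_right L.leaves_pos

end PseudoLoop

/-- Both systems have the same pseudo-loops, since `M` is unchanged, and the shift lowers each
average by `x`. -/
theorem exists_pseudoLoop_shift_iff (S : RSystem V) (x : ℝ) :
    (∃ L : (S.shift x).PseudoLoop, 0 < L.rate) ↔ ∃ L : S.PseudoLoop, x < L.rate := by
  constructor
  · rintro ⟨L, hL⟩
    let L' : S.PseudoLoop :=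
      ⟨L.root, L.tree, L.ne_here, (S.markedLabel_shift x _ _).symm.trans L.label_eq⟩
    refine ⟨L', (lt_div_iff₀ L'.leaves_pos).mpr ?_⟩
    rw [L.rate_pos_iff, markedValue_shift] at hL
    change x * (L.tree.leaves : ℝ) < S.markedValue L.root L.tree
    linarith
  · rintro ⟨L, hL⟩
    refine ⟨⟨L.root, L.tree, L.ne_here, (S.markedLabel_shift x _ _).trans L.label_eq⟩, ?_⟩
    rw [PseudoLoop.rate_pos_iff, markedValue_shift]
    have := (lt_div_iff₀ L.leaves_pos).mp hL
    linarith

/-! ### Cutting pseudo-loops -/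

section Simple

variable [DecidableEq V]

/-- With root label `v`, no path from the root down meets a label twice, or meets a label in `A`. -/
def Simple (S : RSystem V) : Finset V → V → BTree → Prop
  | A, v, .leaf => v ∉ A
  | A, v, .node l r =>
      v ∉ A ∧ S.Simple (insert v A) (S.M v).1 l ∧ S.Simple (insert v A) (S.M v).2 r

/-- The labels on a longest path are distinct and avoid `A`; there are `T.height + 1` of them. -/
theorem Simple.height_add_card_lt [Fintype V] {S : RSystem V} {A : Finset V} {v : V} {T : BTree}
    (h : S.Simple A v T) : T.height + A.card < Fintype.card V := by
  induction T generalizing A v with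
  | leaf =>
    rw [BTree.height, zero_add, Finset.card_lt_iff_ne_univ]
    rintro rfl
    exact h (Finset.mem_univ v)
  | node l r ihl ihr =>
    obtain ⟨hv, hl, hr⟩ := h
    have h1 := ihl hl
    have h2 := ihr hr
    rw [Finset.card_insert_of_notMem hv] at h1 h2
    rw [BTree.height]
    omega

/-- `A` stands for the labels of the ancestors. When the induction returns a hit in `insert v A`, a
hit on `v` closes a loop at the current root, while a hit in `A` is passed upwards. -/
theorem exists_repeated_label {S : RSystem V} {A : Finset V} {v : V} {T : BTree}
    (h : ¬ S.Simple A v T) :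
    (∃ K T', T = MarkedTree.plug K T' ∧ S.markedLabel v K ∈ A) ∨
      ∃ K K' T', T = MarkedTree.plug K (MarkedTree.plug K' T') ∧ K' ≠ .here ∧
        S.markedLabel (S.markedLabel v K) K' = S.markedLabel v K := by
  induction T generalizing A v with
  | leaf => exact Or.inl ⟨.here, .leaf, rfl, not_not.mp h⟩
  | node l r ihl ihr =>
    by_cases hv : v ∈ A
    · exact Or.inl ⟨.here, _, rfl, hv⟩
    by_cases hl : S.Simple (insert v A) (S.M v).1 l
    · have hr : ¬ S.Simple (insert v A) (S.M v).2 r := fun hr => h ⟨hv, hl, hr⟩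
      rcases ihr hr with ⟨K, T', rfl, hK⟩ | ⟨K, K', T', rfl, hne, hK⟩
      · rcases Finset.mem_insert.mp hK with hK | hK
        · exact Or.inr ⟨.here, .inRight l K, T', rfl, by simp, hK⟩
        · exact Or.inl ⟨.inRight l K, T', rfl, hK⟩
      · exact Or.inr ⟨.inRight l K, K', T', rfl, hne, hK⟩
    · rcases ihl hl with ⟨K, T', rfl, hK⟩ | ⟨K, K', T', rfl, hne, hK⟩
      · rcases Finset.mem_insert.mp hK with hK | hK
        · exact Or.inr ⟨.here, .inLeft K r, T', rfl, by simp, hK⟩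
        · exact Or.inl ⟨.inLeft K r, T', rfl, hK⟩
      · exact Or.inr ⟨.inLeft K r, K', T', rfl, hne, hK⟩

theorem exists_pseudoLoop_of_not_simple {S : RSystem V} {v : V} {T : BTree}
    (h : ¬ S.Simple ∅ v T) :
    ∃ (L : S.PseudoLoop) (K : MarkedTree) (T' : BTree),
      T = K.plug (L.tree.plug T') ∧ S.markedLabel v K = L.root := by
  rcases exists_repeated_label h with ⟨K, T', -, hK⟩ | ⟨K, K', T', hT, hne, hK⟩
  · exact absurd hK (Finset.notMem_empty _)
  · exact ⟨⟨_, K', hne, hK⟩, K, T', hT, rfl⟩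

end Simple

/-- A comb of height `|V|` must repeat a label. This makes the supremum of the rates meaningful. -/
theorem nonempty_pseudoLoop [Fintype V] [Nonempty V] (S : RSystem V) : Nonempty S.PseudoLoop := by
  classical
  obtain ⟨v⟩ := ‹Nonempty V›
  have h : ¬ S.Simple ∅ v (BTree.comb (Fintype.card V)) := fun h => by
    simpa [BTree.height_comb] using h.height_add_card_lt
  obtain ⟨L, -⟩ := exists_pseudoLoop_of_not_simple h
  exact ⟨L⟩

/-- If no pseudo-loop has positive rate, every tree is dominated by one of height less than `|V|`. -/
theorem exists_height_lt_card [Fintype V] {S : RSystem V}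
    (hS : ¬ ∃ L : S.PseudoLoop, 0 < L.rate) (v : V) (T : BTree) :
    ∃ T' : BTree, T'.height < Fintype.card V ∧ S.value v T ≤ S.value v T' := by
  classical
  induction hn : T.leaves using Nat.strong_induction_on generalizing T with
  | _ n ih =>
    by_cases h : S.Simple ∅ v T
    · exact ⟨T, by simpa using h.height_add_card_lt, le_rfl⟩
    obtain ⟨L, K, T', rfl, hK⟩ := exists_pseudoLoop_of_not_simple h
    have hL : S.markedValue L.root L.tree ≤ 0 :=
      not_lt.mp fun h => hS ⟨L, L.rate_pos_iff.mpr h⟩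
    have hpos := MarkedTree.leaves_pos L.ne_here
    -- Cutting out the loop removes at least one leaf and a total value that is at most `0`.
    obtain ⟨T'', h1, h2⟩ := ih (K.plug T').leaves
      (by rw [← hn]; simp only [MarkedTree.leaves_plug]; omega) _ rfl
    refine ⟨T'', h1, le_trans ?_ h2⟩
    simp only [value_plug, hK, L.label_eq]
    linarith

theorem exists_isMaxValue [Fintype V] {S : RSystem V}
    (hS : ¬ ∃ L : S.PseudoLoop, 0 < L.rate) (v : V) : ∃ z, S.IsMaxValue v z := by
  have hcard : 0 < Fintype.card V := Fintype.card_pos_iff.mpr ⟨v⟩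
  obtain ⟨T, -, hT⟩ := Set.exists_max_image _ (S.value v)
    (BTree.finite_setOf_height_le (Fintype.card V)) ⟨.leaf, Nat.zero_le _⟩
  refine ⟨S.value v T, ⟨T, rfl⟩, ?_⟩
  rintro _ ⟨T', rfl⟩
  obtain ⟨T'', h1, h2⟩ := exists_height_lt_card hS v T'
  exact h2.trans (hT T'' h1.le)

/-- Putting a positive loop on top of a maximal tree would improve it. -/
theorem not_exists_isMaxValue {S : RSystem V} (L : S.PseudoLoop) (hL : 0 < L.rate) :
    ¬ ∃ z, S.IsMaxValue L.root z := by
  rintro ⟨_, ⟨T, rfl⟩, hT⟩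
  have h := hT ⟨L.tree.plug T, rfl⟩
  rw [value_plug, L.label_eq] at h
  have := L.rate_pos_iff.mp hL
  linarith

theorem exists_not_isMaxValue_iff [Fintype V] (S : RSystem V) :
    (∃ v, ¬ ∃ z, S.IsMaxValue v z) ↔ ∃ L : S.PseudoLoop, 0 < L.rate := by
  constructor
  · rintro ⟨v, hv⟩
    by_contra h
    exact hv (exists_isMaxValue h v)
  · rintro ⟨L, hL⟩
    exact ⟨L.root, not_exists_isMaxValue L hL⟩

/-! ### The growth rate -/

theorem value_le_fn (S : RSystem V) (v : V) (T : BTree) : S.value v T ≤ S.fn T.leaves v := by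
  induction T generalizing v with
  | leaf => exact (S.fn_one v).ge
  | node l r ihl ihr =>
    have hl := l.leaves_pos
    have hr := r.leaves_pos
    refine (add_le_add (ihl _) (ihr _)).trans ?_
    refine (S.fn_isGreatest (l.leaves + r.leaves) (by omega) v).2
      ⟨r.leaves, by omega, by omega, ?_⟩
    rw [Nat.add_sub_cancel]

theorem exists_value_eq_fn (S : RSystem V) (n : ℕ) (hn : 1 ≤ n) (v : V) :
    ∃ T : BTree, T.leaves = n ∧ S.value v T = S.fn n v := by
  induction n using Nat.strong_induction_on generalizing v with
  | _ n ih =>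
    obtain rfl | h2 : n = 1 ∨ 2 ≤ n := by omega
    · exact ⟨.leaf, rfl, (S.fn_one v).symm⟩
    obtain ⟨m, h3, h4, h5⟩ := (S.fn_isGreatest n h2 v).1
    obtain ⟨l, hl, hl'⟩ := ih (n - m) (by omega) (by omega) (S.M v).1
    obtain ⟨r, hr, hr'⟩ := ih m (by omega) h3 (S.M v).2
    exact ⟨.node l r, by rw [BTree.leaves]; omega, by rw [value, hl', hr', h5]⟩

variable [Fintype V] [Nonempty V]

theorem value_le_g (S : RSystem V) (v : V) (T : BTree) : S.value v T ≤ S.g T.leaves :=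
  (S.value_le_fn v T).trans (Finset.le_sup' (fun v => S.fn T.leaves v) (Finset.mem_univ v))

theorem exists_value_eq_g (S : RSystem V) (n : ℕ) (hn : 1 ≤ n) :
    ∃ (v : V) (T : BTree), T.leaves = n ∧ S.value v T = S.g n := by
  obtain ⟨v, -, hv⟩ := Finset.exists_mem_eq_sup' (Finset.univ_nonempty (α := V))
    (fun v : V => S.fn n v)
  obtain ⟨T, hT, hT'⟩ := S.exists_value_eq_fn n hn v
  exact ⟨v, T, hT, hT'.trans hv.symm⟩

/-- A tree with `n` leaves loses `n * x` in the shift, and its shifted value is at most one of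
finitely many maxima. -/
theorem exists_g_le {S : RSystem V} {x : ℝ} (hS : ∀ L : S.PseudoLoop, L.rate ≤ x) :
    ∃ Z : ℝ, ∀ n : ℕ, 1 ≤ n → S.g n ≤ n * x + Z := by
  have hx : ¬ ∃ L : (S.shift x).PseudoLoop, 0 < L.rate := by
    rw [exists_pseudoLoop_shift_iff]
    rintro ⟨L, hL⟩
    exact hL.not_ge (hS L)
  choose z hz using exists_isMaxValue hx
  refine ⟨∑ v, |z v|, fun n hn => ?_⟩
  obtain ⟨v, T, rfl, hT⟩ := S.exists_value_eq_g n hn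
  have h1 := (hz v).2 ⟨T, rfl⟩
  have h2 := Finset.single_le_sum (f := fun v => |z v|) (fun _ _ => abs_nonneg _)
    (Finset.mem_univ v)
  have h3 := le_abs_self (z v)
  rw [value_shift] at h1
  linarith

theorem exists_le_g (S : RSystem V) (L : S.PseudoLoop) :
    ∃ E : ℝ, ∀ n : ℕ, 1 ≤ n → n * L.rate - E ≤ S.g n := by
  -- `d j` is the shortfall of the comb with `j + 1` leaves. A comb with `j < k` under `m` copies of
  -- the loop reaches every size `n = m * k + j + 1`, hence the division of `n - 1`.
  let d : ℕ → ℝ := fun j => ((j : ℝ) + 1) * L.rate - S.value L.root (BTree.comb j)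
  refine ⟨∑ j ∈ Finset.range L.tree.leaves, |d j|, fun n hn => ?_⟩
  have hk := MarkedTree.leaves_pos L.ne_here
  set k := L.tree.leaves with hkdef
  set j := (n - 1) % k with hj
  set m := (n - 1) / k with hm
  have hjk : j < k := Nat.mod_lt _ hk
  have hdiv : m * k + j = n - 1 := Nat.div_add_mod' (n - 1) k
  have hleaves : (L.tree.plug^[m] (BTree.comb j)).leaves = n := by
    rw [MarkedTree.leaves_iterate_plug, BTree.leaves_comb, ← hkdef]; omega
  have hcast : (n : ℝ) = m * k + j + 1 := by
    rw [← Nat.sub_add_cancel hn, ← hdiv]; push_cast; ring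
  have hval : S.markedValue L.root L.tree = k * L.rate := by
    rw [PseudoLoop.rate, mul_div_cancel₀ _ L.leaves_pos.ne']
  have h1 := S.value_le_g L.root (L.tree.plug^[m] (BTree.comb j))
  rw [hleaves, value_iterate_plug, hval] at h1
  have h2 := Finset.single_le_sum (f := fun j => |d j|) (fun _ _ => abs_nonneg _)
    (Finset.mem_range.mpr hjk)
  have h3 := le_abs_self (d j)
  have h4 : d j = ((j : ℝ) + 1) * L.rate - S.value L.root (BTree.comb j) := rfl
  rw [hcast]
  linarith

omit [Nonempty V] in
-- A rate is an average of starting values, each at most `∑ v, |S.c v|`.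
theorem bddAbove_range_rate (S : RSystem V) :
    BddAbove (Set.range fun L : S.PseudoLoop => L.rate) := by
  let B := ∑ v, |S.c v|
  have hc : ∀ v, S.c v ≤ B := fun v => (le_abs_self _).trans
    (Finset.single_le_sum (f := fun v => |S.c v|) (fun _ _ => abs_nonneg _) (Finset.mem_univ v))
  have hT : ∀ (T : BTree) (v : V), S.value v T ≤ T.leaves * B := by
    intro T
    induction T with
    | leaf => intro v; simpa [value, BTree.leaves] using hc v
    | node l r ihl ihr =>
      intro v
      have h1 := ihl (S.M v).1
      have h2 := ihr (S.M v).2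
      simp only [value, BTree.leaves]
      push_cast
      linarith
  have hK : ∀ (K : MarkedTree) (v : V), S.markedValue v K ≤ K.leaves * B := by
    intro K
    induction K with
    | here => intro v; simp [markedValue, MarkedTree.leaves]
    | inLeft K r ih =>
      intro v
      have h1 := ih (S.M v).1
      have h2 := hT r (S.M v).2
      simp only [markedValue, MarkedTree.leaves]
      push_cast
      linarith
    | inRight l K ih =>
      intro v
      have h1 := hT l (S.M v).1
      have h2 := ih (S.M v).2
      simp only [markedValue, MarkedTree.leaves]
      push_cast
      linarith
  refine ⟨B, ?_⟩
  rintro _ ⟨L, rfl⟩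
  refine (div_le_iff₀ L.leaves_pos).mpr ?_
  rw [mul_comm]
  exact hK _ _

/-- The growth rate exists; it is the supremum of the rates of the pseudo-loops. -/
theorem isGrowthRate_sSup (S : RSystem V) :
    S.IsGrowthRate (sSup (Set.range fun L : S.PseudoLoop => L.rate)) := by
  have := S.nonempty_pseudoLoop
  have hne := Set.range_nonempty fun L : S.PseudoLoop => L.rate
  have hlim : ∀ x E : ℝ, Tendsto (fun n : ℕ => x + E / (n : ℝ)) atTop (𝓝 x) := fun x E => by
    simpa using (tendsto_const_nhds (x := x)).add (tendsto_const_div_atTop_nhds_zero_nat E)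
  refine tendsto_order.mpr ⟨fun a ha => ?_, fun a ha => ?_⟩
  · obtain ⟨_, ⟨L, rfl⟩, hL⟩ := exists_lt_of_lt_csSup hne ha
    obtain ⟨E, hE⟩ := S.exists_le_g L
    filter_upwards [(hlim L.rate (-E)).eventually_const_lt hL, eventually_ge_atTop 1] with n h1 h2
    have hn : (0 : ℝ) < n := Nat.cast_pos.mpr h2
    refine h1.trans_le ((le_div_iff₀ hn).mpr ?_)
    rw [add_mul, div_mul_cancel₀ _ hn.ne', mul_comm]
    exact hE n h2
  · obtain ⟨Z, hZ⟩ := exists_g_le (S := S) fun L => le_csSup S.bddAbove_range_rate ⟨L, rfl⟩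
    filter_upwards [(hlim _ Z).eventually_lt_const ha, eventually_ge_atTop 1] with n h1 h2
    have hn : (0 : ℝ) < n := Nat.cast_pos.mpr h2
    refine lt_of_le_of_lt ((div_le_iff₀ hn).mpr ?_) h1
    rw [add_mul, div_mul_cancel₀ _ hn.ne', mul_comm]
    exact hZ n h2

theorem lt_sSup_rate_iff (S : RSystem V) (x : ℝ) :
    x < sSup (Set.range fun L : S.PseudoLoop => L.rate) ↔
      ∃ L : (S.shift x).PseudoLoop, 0 < L.rate := by
  have := S.nonempty_pseudoLoop
  rw [exists_pseudoLoop_shift_iff, lt_csSup_iff S.bddAbove_range_rate (Set.range_nonempty _)]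
  simp

end RSystem

/-! ### Value iteration in place -/

/-- The state `z` of the iteration in sweep number `r`, when the first `k` entries have been treated;
`f` is `1` if this sweep has changed an entry, and `0` otherwise. -/
structure Sweep {n : ℕ} (S : RSystem (Fin n)) (r k : ℕ) (z : Fin n → ℝ) (f : ℕ) : Prop where
  isValue : ∀ v, z v ∈ Set.range (S.value v)
  le : ∀ v (T : BTree), T.height ≤ r → S.value v T ≤ z v
  le_succ : ∀ v : Fin n, v.1 < k → ∀ T : BTree, T.height ≤ r + 1 → S.value v T ≤ z v
  -- With `f = 0` the vector is untouched in this sweep, so the inequalities tested earlier still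
  -- hold. With `f = 1` the witness tree survives all later changes, as it does not refer to `z`.
  flag : (f = 0 ∧ ∀ v : Fin n, v.1 < k → z (S.M v).1 + z (S.M v).2 ≤ z v) ∨
    (f = 1 ∧ ∃ v T, ∀ T' : BTree, T'.height ≤ r → S.value v T' < S.value v T)

namespace Sweep

variable {n : ℕ} {S : RSystem (Fin n)} {r k f : ℕ} {z : Fin n → ℝ}

theorem init (S : RSystem (Fin n)) : Sweep S 0 0 S.c 0 where
  isValue _ := ⟨.leaf, rfl⟩
  le v T hT := by
    cases T with
    | leaf => exact le_rfl
    | node l r => simp [BTree.height] at hT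
  le_succ _ hv := absurd hv (Nat.not_lt_zero _)
  flag := Or.inl ⟨rfl, fun _ hv => absurd hv (Nat.not_lt_zero _)⟩

theorem next (h : Sweep S r n z f) : Sweep S (r + 1) 0 z 0 where
  isValue := h.isValue
  le v := h.le_succ v v.2
  le_succ _ hv := absurd hv (Nat.not_lt_zero _)
  flag := Or.inl ⟨rfl, fun _ hv => absurd hv (Nat.not_lt_zero _)⟩

theorem value_le_of_height_le_succ (h : Sweep S r k z f) {v : Fin n} {x : ℝ} (hx : z v ≤ x)
    (hx' : z (S.M v).1 + z (S.M v).2 ≤ x) (T : BTree) (hT : T.height ≤ r + 1) :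
    S.value v T ≤ x := by
  cases T with
  | leaf => exact (h.le v .leaf (Nat.zero_le _)).trans hx
  | node a b =>
    simp only [BTree.height, Nat.add_le_add_iff_right, max_le_iff] at hT
    exact (add_le_add (h.le _ a hT.1) (h.le _ b hT.2)).trans hx'

theorem keep (h : Sweep S r k z f) (hk : k < n)
    (hz : z (S.M ⟨k, hk⟩).1 + z (S.M ⟨k, hk⟩).2 ≤ z ⟨k, hk⟩) : Sweep S r (k + 1) z f where
  isValue := h.isValue
  le := h.le
  le_succ v hv := by
    rcases Nat.lt_succ_iff_lt_or_eq.mp hv with hv | hv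
    · exact h.le_succ v hv
    · obtain rfl : v = ⟨k, hk⟩ := Fin.ext hv
      exact h.value_le_of_height_le_succ le_rfl hz
  flag := by
    refine h.flag.imp (fun h' => ⟨h'.1, fun v hv => ?_⟩) id
    rcases Nat.lt_succ_iff_lt_or_eq.mp hv with hv | hv
    · exact h'.2 v hv
    · obtain rfl : v = ⟨k, hk⟩ := Fin.ext hv
      exact hz

theorem change (h : Sweep S r k z f) (hk : k < n)
    (hz : z ⟨k, hk⟩ < z (S.M ⟨k, hk⟩).1 + z (S.M ⟨k, hk⟩).2) :
    Sweep S r (k + 1)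
      (Function.update z ⟨k, hk⟩ (z (S.M ⟨k, hk⟩).1 + z (S.M ⟨k, hk⟩).2)) 1 := by
  obtain ⟨a, ha⟩ := h.isValue (S.M ⟨k, hk⟩).1
  obtain ⟨b, hb⟩ := h.isValue (S.M ⟨k, hk⟩).2
  have hab : S.value ⟨k, hk⟩ (.node a b) = z (S.M ⟨k, hk⟩).1 + z (S.M ⟨k, hk⟩).2 := by
    rw [RSystem.value, ha, hb]
  have hle : z ≤ Function.update z ⟨k, hk⟩ (z (S.M ⟨k, hk⟩).1 + z (S.M ⟨k, hk⟩).2) :=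
    le_update_self_iff.mpr hz.le
  -- Entries only grow, so old lower bounds persist. The tree `.node a b` realizes the new entry and
  -- beats the old one, which dominated all heights up to `r`.
  refine ⟨fun v => ?_, fun v T hT => (h.le v T hT).trans (hle v), fun v hv T hT => ?_,
    Or.inr ⟨rfl, ⟨k, hk⟩, .node a b, fun T' hT' => ?_⟩⟩
  · by_cases hv : v = ⟨k, hk⟩
    · subst hv
      rw [Function.update_self]
      exact ⟨_, hab⟩
    · rw [Function.update_of_ne hv]
      exact h.isValue v
  · by_cases hv' : v = ⟨k, hk⟩
    · subst hv'
      rw [Function.update_self]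
      exact h.value_le_of_height_le_succ hz.le le_rfl T hT
    · refine (h.le_succ v ?_ T hT).trans (hle v)
      exact (Nat.lt_succ_iff_lt_or_eq.mp hv).resolve_right fun e => hv' (Fin.ext e)
  · rw [hab]
    exact (h.le _ T' hT').trans_lt hz

/-- The inequalities of an unchanged sweep propagate the bound from subtrees to trees of any height.
-/
theorem isMaxValue (h : Sweep S r n z 0) (v : Fin n) : S.IsMaxValue v (z v) := by
  refine ⟨h.isValue v, ?_⟩
  rintro _ ⟨T, rfl⟩
  have hz := (h.flag.resolve_right fun h' => absurd h'.1 (by simp)).2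
  induction T generalizing v with
  | leaf => exact h.le v .leaf (Nat.zero_le _)
  | node a b iha ihb => exact (add_le_add (iha _) (ihb _)).trans (hz v v.2)

theorem exists_pseudoLoop (h : Sweep S r k z 1) (hr : n ≤ r + 1) :
    ∃ L : S.PseudoLoop, 0 < L.rate := by
  obtain ⟨v, T, hT⟩ := (h.flag.resolve_left fun h' => absurd h'.1 (by simp)).2
  by_contra hS
  obtain ⟨T', h1, h2⟩ := RSystem.exists_height_lt_card hS v T
  rw [Fintype.card_fin] at h1
  exact (hT T' (by omega)).not_ge h2

end Sweep

/-! ### The program -/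

theorem Program.run_add (P : Program) (s : Config) (a b : ℕ) :
    P.run s (a + b) = P.run (P.run s a) b := by
  rw [Program.run, add_comm, Function.iterate_add_apply]; rfl

/-- Within `b` steps from `s`, the program reaches a configuration with the property `Q`. -/
def Program.Reaches (P : Program) (s : Config) (b : ℕ) (Q : Config → Prop) : Prop :=
  ∃ t ≤ b, Q (P.run s t)

theorem Program.Reaches.trans {P : Program} {s : Config} {a b : ℕ} {Q R : Config → Prop}
    (h : P.Reaches s a Q) (h' : ∀ s', Q s' → P.Reaches s' b R) : P.Reaches s (a + b) R := by
  obtain ⟨t, ht, hQ⟩ := h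
  obtain ⟨t', ht', hR⟩ := h' _ hQ
  exact ⟨t + t', add_le_add ht ht', by rwa [Program.run_add]⟩

theorem Program.Reaches.mono {P : Program} {s : Config} {a b : ℕ} {Q R : Config → Prop}
    (h : P.Reaches s a Q) (hab : a ≤ b) (hQR : ∀ s, Q s → R s) : P.Reaches s b R :=
  let ⟨t, ht, hQ⟩ := h
  ⟨t, ht.trans hab, hQR _ hQ⟩

/-- Subtract `x` from all starting values (lines 0-4); then do `n` sweeps (lines 5-23) that replace
`z v` by `max (z v) (z u + z w)`, and report whether the last one has changed anything. Registers: `1`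
holds `v`, `2` the address of `M v`, `5` the number of finished sweeps, `7` the flag. -/
def growthProgram : Program := [
  .rload 1 1, .rsub 1 1 0, .rstore 1 1, .succ 1, .jlt 1 0 0,
  .const 7 0, .const 1 0, .const 2 0,
  .load 3 2, .succ 2, .load 4 2, .succ 2,
  .rload 1 3, .rload 2 4, .radd 1 1 2, .rload 2 1, .rjlt 2 1 18, .jump 20,
  .rstore 1 1, .const 7 1,
  .succ 1, .jlt 1 0 8,
  .succ 5, .jlt 5 0 5,
  .copy 0 7]

/-- The index memory from the cell `0` on holds the pairs of `S`, register `0` the size. -/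
structure Holds {n : ℕ} (S : RSystem (Fin n)) (s : Config) : Prop where
  size : s.reg 0 = n
  fst : ∀ v : Fin n, s.mem (2 * v) = (S.M v).1
  snd : ∀ v : Fin n, s.mem (2 * v + 1) = (S.M v).2

/-- The invariant of the loop in lines 0-4, which has treated the first `k` values. -/
structure ShiftInv {n : ℕ} (S : RSystem (Fin n)) (x : ℝ) (k : ℕ) (s : Config) : Prop where
  holds : Holds (S.shift x) s
  index : s.reg 1 = k
  rounds : s.reg 5 = 0
  shift : s.rreg 0 = x
  done : ∀ v : Fin n, v.1 < k → s.rmem v = S.c v - x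
  todo : ∀ v : Fin n, k ≤ v.1 → s.rmem v = S.c v

/-- The invariant of the loop in lines 8-21. -/
structure SweepInv {n : ℕ} (S : RSystem (Fin n)) (r k : ℕ) (s : Config) : Prop where
  holds : Holds S s
  index : s.reg 1 = k
  addr : s.reg 2 = 2 * k
  rounds : s.reg 5 = r
  sweep : Sweep S r k (fun v => s.rmem v) (s.reg 7)

/-! ### Execution of the program blocks and preservation of the invariants -/

section Machine

theorem run_shift (reg : ℕ → ℕ) (rreg : ℕ → ℝ) (mem : ℕ → ℕ) (rmem : ℕ → ℝ) :
    ∃ rreg' : ℕ → ℝ, rreg' 0 = rreg 0 ∧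
      growthProgram.run ⟨0, reg, rreg, mem, rmem⟩ 5 =
        ⟨if reg 1 + 1 < reg 0 then 0 else 5, Function.update reg 1 (reg 1 + 1), rreg', mem,
          Function.update rmem (reg 1) (rmem (reg 1) - rreg 0)⟩ := by
  refine ⟨Function.update (Function.update rreg 1 (rmem (reg 1))) 1 (rmem (reg 1) - rreg 0),
    by simp, ?_⟩
  simp [Program.run, Program.step, growthProgram, Instr.exec]

theorem run_reset (reg : ℕ → ℕ) (rreg : ℕ → ℝ) (mem : ℕ → ℕ) (rmem : ℕ → ℝ) :
    growthProgram.run ⟨5, reg, rreg, mem, rmem⟩ 3 =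
      ⟨8, Function.update (Function.update (Function.update reg 7 0) 1 0) 2 0, rreg, mem, rmem⟩ := by
  simp [Program.run, Program.step, growthProgram, Instr.exec]

theorem run_sweep (reg : ℕ → ℕ) (rreg : ℕ → ℝ) (mem : ℕ → ℕ) (rmem : ℕ → ℝ) :
    ∃ t ≤ 13, ∃ (reg' : ℕ → ℕ) (rreg' : ℕ → ℝ),
      (reg' 0 = reg 0 ∧ reg' 1 = reg 1 + 1 ∧ reg' 2 = reg 2 + 2 ∧ reg' 5 = reg 5 ∧
        reg' 7 = if rmem (reg 1) < rmem (mem (reg 2)) + rmem (mem (reg 2 + 1)) then 1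
          else reg 7) ∧
      growthProgram.run ⟨8, reg, rreg, mem, rmem⟩ t =
        ⟨if reg 1 + 1 < reg 0 then 8 else 22, reg', rreg', mem,
          if rmem (reg 1) < rmem (mem (reg 2)) + rmem (mem (reg 2 + 1)) then
            Function.update rmem (reg 1) (rmem (mem (reg 2)) + rmem (mem (reg 2 + 1)))
          else rmem⟩ := by
  -- The updating branch takes 13 steps, the other 12; the final registers are taken from the run
  -- itself.
  by_cases h : rmem (reg 1) < rmem (mem (reg 2)) + rmem (mem (reg 2 + 1))
  · refine ⟨13, le_rfl, (growthProgram.run ⟨8, reg, rreg, mem, rmem⟩ 13).reg,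
      (growthProgram.run ⟨8, reg, rreg, mem, rmem⟩ 13).rreg, ?_⟩
    simp [Program.run, Program.step, growthProgram, Instr.exec, h]
  · refine ⟨12, by omega, (growthProgram.run ⟨8, reg, rreg, mem, rmem⟩ 12).reg,
      (growthProgram.run ⟨8, reg, rreg, mem, rmem⟩ 12).rreg, ?_⟩
    simp [Program.run, Program.step, growthProgram, Instr.exec, h]

theorem run_next (reg : ℕ → ℕ) (rreg : ℕ → ℝ) (mem : ℕ → ℕ) (rmem : ℕ → ℝ) :
    growthProgram.run ⟨22, reg, rreg, mem, rmem⟩ 2 =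
      ⟨if reg 5 + 1 < reg 0 then 5 else 24, Function.update reg 5 (reg 5 + 1), rreg, mem, rmem⟩ := by
  simp [Program.run, Program.step, growthProgram, Instr.exec]

theorem run_report (reg : ℕ → ℕ) (rreg : ℕ → ℝ) (mem : ℕ → ℕ) (rmem : ℕ → ℝ) :
    growthProgram.run ⟨24, reg, rreg, mem, rmem⟩ 1 =
      ⟨25, Function.update reg 0 (reg 7), rreg, mem, rmem⟩ := by
  simp [Program.run, Program.step, growthProgram, Instr.exec]

variable {n : ℕ} {S : RSystem (Fin n)}

theorem shiftInv_inputConfig (S : RSystem (Fin n)) (x : ℝ) :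
    ShiftInv S x 0 (inputConfig S x) where
  holds := by
    refine ⟨by simp [inputConfig], fun v => ?_, fun v => ?_⟩
    · have h : 2 * v.1 / 2 = v.1 := by omega
      simp [inputConfig, h, RSystem.shift]
    · have h : (2 * v.1 + 1) / 2 = v.1 := by omega
      have h' : (2 * v.1 + 1) % 2 = 1 := by omega
      simp [inputConfig, h, h', RSystem.shift]
  index := by simp [inputConfig]
  rounds := by simp [inputConfig]
  shift := by simp [inputConfig]
  done v hv := absurd hv (Nat.not_lt_zero _)
  todo v _ := by simp [inputConfig]

theorem reaches_shift_step {x : ℝ} {k : ℕ} {s : Config} (hpc : s.pc = 0)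
    (h : ShiftInv S x k s) :
    growthProgram.Reaches s 5 fun s' =>
      s'.pc = (if k + 1 < n then 0 else 5) ∧ ShiftInv S x (k + 1) s' := by
  obtain ⟨pc, reg, rreg, mem, rmem⟩ := s
  obtain ⟨⟨h0, hf, hs⟩, h1, h5, hx, hd, ht⟩ := h
  dsimp only at hpc h0 hf hs h1 h5 hx hd ht
  subst hpc
  obtain ⟨rreg', hr, hrun⟩ := run_shift reg rreg mem rmem
  refine ⟨5, le_rfl, ?_⟩
  rw [hrun, h0, h1, hx]
  refine ⟨rfl, ⟨by simpa using h0, hf, hs⟩, by simp, by simpa using h5, hr.trans hx,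
    fun v hv => ?_, fun v hv => ?_⟩
  · rcases Nat.lt_succ_iff_lt_or_eq.mp hv with hv | hv
    · simpa [Function.update_of_ne hv.ne] using hd v hv
    · simp [← hv, ht v hv.ge]
  · have hne : v.1 ≠ k := by omega
    simpa [Function.update_of_ne hne] using ht v (by omega)

/-- The loop tests its condition only at the end, so `n` must be positive. -/
theorem reaches_shift [NeZero n] {x : ℝ} {s : Config} (hpc : s.pc = 0) (h : ShiftInv S x 0 s) :
    growthProgram.Reaches s (5 * n) fun s' => s'.pc = 5 ∧ ShiftInv S x n s' := by
  have key : ∀ k ≤ n, growthProgram.Reaches s (5 * k) fun s' =>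
      s'.pc = (if k < n then 0 else 5) ∧ ShiftInv S x k s' := by
    intro k
    induction k with
    | zero => exact fun _ => ⟨0, le_rfl, by simpa [Program.run, NeZero.pos n] using hpc, h⟩
    | succ k ih =>
      intro hk
      refine (ih (by omega)).trans fun s' hs' => ?_
      exact reaches_shift_step (by simpa [show k < n by omega] using hs'.1) hs'.2
  simpa using key n le_rfl

theorem reaches_sweep_step {r k : ℕ} {s : Config} (hpc : s.pc = 8)
    (h : SweepInv S r k s) (hk : k < n) :
    growthProgram.Reaches s 13 fun s' =>
      s'.pc = (if k + 1 < n then 8 else 22) ∧ SweepInv S r (k + 1) s' := by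
  obtain ⟨pc, reg, rreg, mem, rmem⟩ := s
  obtain ⟨⟨h0, hf, hs⟩, h1, h2, h5, hz⟩ := h
  dsimp only at hpc h0 hf hs h1 h2 h5 hz
  subst hpc
  obtain ⟨t, ht, reg', rreg', ⟨h0', h1', h2', h5', h7'⟩, hrun⟩ := run_sweep reg rreg mem rmem
  refine ⟨t, ht, ?_⟩
  have hu := hf ⟨k, hk⟩
  have hw := hs ⟨k, hk⟩
  dsimp only at hu hw
  rw [h1, h2, hu, hw] at h7' hrun
  rw [hrun, h0]
  refine ⟨rfl, ⟨h0'.trans h0, hf, hs⟩, h1'.trans (congrArg (· + 1) h1), ?_, h5'.trans h5, ?_⟩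
  · change reg' 2 = _
    omega
  dsimp only
  rw [h7']
  split_ifs with hlt
  · convert hz.change hk hlt using 1
    funext v
    by_cases hv : v = ⟨k, hk⟩
    · subst hv; simp
    · rw [Function.update_of_ne hv, Function.update_of_ne fun e => hv (Fin.ext e)]
  · exact hz.keep hk (not_lt.mp hlt)

theorem reaches_sweep [NeZero n] {r : ℕ} {s : Config} (hpc : s.pc = 8) (h : SweepInv S r 0 s) :
    growthProgram.Reaches s (13 * n) fun s' => s'.pc = 22 ∧ SweepInv S r n s' := by
  have key : ∀ k ≤ n, growthProgram.Reaches s (13 * k) fun s' =>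
      s'.pc = (if k < n then 8 else 22) ∧ SweepInv S r k s' := by
    intro k
    induction k with
    | zero => exact fun _ => ⟨0, le_rfl, by simpa [Program.run, NeZero.pos n] using hpc, h⟩
    | succ k ih =>
      intro hk
      refine (ih (by omega)).trans fun s' hs' => ?_
      exact reaches_sweep_step (by simpa [show k < n by omega] using hs'.1) hs'.2 (by omega)
  simpa using key n le_rfl

theorem reaches_reset {r : ℕ} {s : Config} (hpc : s.pc = 5) (h : Holds S s) (h5 : s.reg 5 = r)
    (hz : Sweep S r 0 (fun v => s.rmem v) 0) :
    growthProgram.Reaches s 3 fun s' => s'.pc = 8 ∧ SweepInv S r 0 s' := by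
  obtain ⟨pc, reg, rreg, mem, rmem⟩ := s
  obtain ⟨h0, hf, hs⟩ := h
  dsimp only at hpc h0 hf hs h5 hz
  subst hpc
  refine ⟨3, le_rfl, ?_⟩
  rw [run_reset]
  exact ⟨rfl, ⟨by simpa using h0, hf, hs⟩, by simp, by simp, by simpa using h5, by simpa using hz⟩

theorem reaches_round [NeZero n] {r : ℕ} {s : Config} (hpc : s.pc = 5) (h : Holds S s)
    (h5 : s.reg 5 = r) (hz : Sweep S r 0 (fun v => s.rmem v) 0) :
    growthProgram.Reaches s (3 + 13 * n + 2) fun s' =>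
      s'.pc = (if r + 1 < n then 5 else 24) ∧ Holds S s' ∧ s'.reg 5 = r + 1 ∧
        Sweep S r n (fun v => s'.rmem v) (s'.reg 7) := by
  refine ((reaches_reset hpc h h5 hz).trans fun s' hs' => reaches_sweep hs'.1 hs'.2).trans ?_
  rintro ⟨pc, reg, rreg, mem, rmem⟩ ⟨hpc, ⟨h0, hf, hs⟩, -, -, h5, hz⟩
  dsimp only at hpc h0 hf hs h5 hz
  subst hpc
  refine ⟨2, le_rfl, ?_⟩
  rw [run_next, h0, h5]
  exact ⟨rfl, ⟨by simpa using h0, hf, hs⟩, by simp, by simpa using hz⟩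

theorem reaches_rounds [NeZero n] {s : Config} (hpc : s.pc = 5) (h : Holds S s)
    (h5 : s.reg 5 = 0) (hz : Sweep S 0 0 (fun v => s.rmem v) 0) :
    growthProgram.Reaches s (n * (3 + 13 * n + 2)) fun s' =>
      s'.pc = 24 ∧ Sweep S (n - 1) n (fun v => s'.rmem v) (s'.reg 7) := by
  have key : ∀ r < n, growthProgram.Reaches s ((r + 1) * (3 + 13 * n + 2)) fun s' =>
      s'.pc = (if r + 1 < n then 5 else 24) ∧ Holds S s' ∧ s'.reg 5 = r + 1 ∧
        Sweep S r n (fun v => s'.rmem v) (s'.reg 7) := by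
    intro r
    induction r with
    | zero => intro _; simpa using reaches_round hpc h h5 hz
    | succ r ih =>
      intro hr
      rw [Nat.succ_mul]
      refine (ih (by omega)).trans fun s' ⟨h1, h2, h3, h4⟩ => ?_
      exact reaches_round (by simpa [hr] using h1) h2 h3 h4.next
  have hn := NeZero.pos n
  have := key (n - 1) (by omega)
  rw [Nat.sub_add_cancel hn] at this
  exact this.mono le_rfl fun s' h => ⟨by simpa using h.1, h.2.2.2⟩

theorem reaches_halt [NeZero n] (S : RSystem (Fin n)) (x : ℝ) :
    growthProgram.Reaches (inputConfig S x) (24 * n ^ 2) fun s =>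
      growthProgram.Halted s ∧
        Sweep (S.shift x) (n - 1) n (fun v => s.rmem v) (s.reg 0) := by
  have hn := NeZero.pos n
  -- The total is `13 * n ^ 2 + 10 * n + 1`, at most `24 * n ^ 2` because `1 ≤ n`.
  refine Program.Reaches.mono (a := 5 * n + n * (3 + 13 * n + 2) + 1) ?_ (by nlinarith)
    fun s h => h
  have h : growthProgram.Reaches (inputConfig S x) (5 * n + n * (3 + 13 * n + 2)) fun s' =>
      s'.pc = 24 ∧ Sweep (S.shift x) (n - 1) n (fun v => s'.rmem v) (s'.reg 7) := by
    refine (reaches_shift rfl (shiftInv_inputConfig S x)).trans fun s hs => ?_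
    refine reaches_rounds hs.1 hs.2.holds hs.2.rounds ?_
    convert Sweep.init (S.shift x) using 1
    funext v
    exact hs.2.done v v.2
  refine h.trans ?_
  rintro ⟨pc, reg, rreg, mem, rmem⟩ ⟨hpc, hz⟩
  dsimp only at hpc hz
  subst hpc
  refine ⟨1, le_rfl, ?_⟩
  rw [run_report]
  exact ⟨by simp [Program.Halted, growthProgram], by simpa using hz⟩

end Machine

end Replacement

theorem theorem5 :
    ∃ (P : Replacement.Program) (C : ℕ), ∀ (n : ℕ) [NeZero n] (S : Replacement.RSystem (Fin n)),
      ∃ lam : ℝ, S.IsGrowthRate lam ∧ ∀ lam₀ : ℝ,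
        -- the machine halts after at most `C * n ^ 2` steps, in a configuration `s`
        (∃ t ≤ C * n ^ 2, ∃ s : Replacement.Config,
          s = P.run (Replacement.inputConfig S lam₀) t ∧ P.Halted s ∧
          -- it reports whether `lam₀ < lam`
          (lam₀ < lam → s.reg 0 = 1) ∧ (¬ lam₀ < lam → s.reg 0 = 0) ∧
          -- if it reports `0`, it has computed all the maximal tree values of the shifted system
          (s.reg 0 = 0 → ∀ v : Fin n, (S.shift lam₀).IsMaxValue v (s.rmem v))) ∧
        -- `lam₀ < lam` exactly when some maximum fails to exist
        (lam₀ < lam ↔ ∃ v : Fin n, ¬ ∃ z : ℝ, (S.shift lam₀).IsMaxValue v z) ∧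
        -- that is, exactly when the shifted system has a pseudo-loop of positive rate
        (lam₀ < lam ↔ ∃ L : (S.shift lam₀).PseudoLoop, 0 < L.rate) := by
  refine ⟨Replacement.growthProgram, 24, fun n _ S => ⟨_, S.isGrowthRate_sSup, fun x => ?_⟩⟩
  have hlt := S.lt_sSup_rate_iff x
  refine ⟨?_, hlt.trans (S.shift x).exists_not_isMaxValue_iff.symm, hlt⟩
  obtain ⟨t, ht, hhalt, hz⟩ := Replacement.reaches_halt S x
  refine ⟨t, ht, _, rfl, hhalt, ?_, ?_, fun h => (h ▸ hz).isMaxValue⟩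
  -- Flag `0` would give a maximum at the root of the positive loop.
  · rw [hlt]
    rintro ⟨L, hL⟩
    refine (hz.flag.resolve_left fun h => ?_).1
    exact Replacement.RSystem.not_exists_isMaxValue L hL ⟨_, (h.1 ▸ hz).isMaxValue L.root⟩
  -- Flag `1` in the last sweep, where `r = n - 1`, would give a positive loop.
  · rw [hlt]
    intro h
    refine (hz.flag.resolve_right fun h' => h ?_).1
    exact (h'.1 ▸ hz).exists_pseudoLoop (by omega)
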